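/- For $x\in\mathbb{R}$ let $\|x\|=\min_{m\in\mathbb{Z}}|x-m|$ denote the distance from $x$ to the nearest integer. For $\mathbf{v}=(v_1,v_2)\in\mathbb{R}^2$ and real $t\ge 1$ put $$\psi_{\mathbf{v}}(t)=\min_{q\in\mathbb{Z},\ 1\le q\le t}\sqrt{\|q v_1\|^2+\|q v_2\|^2},$$ and define the two-dimensional Dirichlet spectrum in the Euclidean norm as $$\mathbb{D}_2=\Bigl\{\lambda\in\mathbb{R}\ \Bigm|\ \exists\,\mathbf{v}\in\mathbb{R}^2:\ \limsup_{t\to\infty} t\cdot\psi_{\mathbf{v}}(t)^2=\lambda\Bigr\}.$$ Then $$\mathbb{D}_2=\left[0,\frac{2}{\sqrt{3}}\right].$$ -/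

import Mathlib

namespace DirichletSpectrum

/-- The distance `‖x‖` from a real number `x` to the nearest integer. -/
noncomputable def distInt (x : ℝ) : ℝ :=
  |x - round x|

/-- `distInt x` is the minimum of `|x - m|` over the integers `m`. -/
theorem isLeast_distInt (x : ℝ) :
    IsLeast (Set.range fun m : ℤ => |x - m|) (distInt x) := by
  refine ⟨⟨round x, rfl⟩, ?_⟩
  rintro _ ⟨m, rfl⟩
  exact round_le x m

/-- The set of the numbers `√(‖q v₁‖² + ‖q v₂‖²)`, where `q` runs through the integers with
`1 ≤ q ≤ t`. -/
def approxErrors (v : EuclideanSpace ℝ (Fin 2)) (t : ℝ) : Set ℝ :=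
  {r | ∃ q : ℕ, 1 ≤ q ∧ (q : ℝ) ≤ t ∧
    r = Real.sqrt (distInt (q * v 0) ^ 2 + distInt (q * v 1) ^ 2)}

/-- The two-dimensional irrationality measure function
`ψ_v(t) = min_{1 ≤ q ≤ t} √(‖q v₁‖² + ‖q v₂‖²)` in the Euclidean norm. It is meaningful for
`t ≥ 1`, and there the infimum is a minimum (`isLeast_psi`). -/
noncomputable def psi (v : EuclideanSpace ℝ (Fin 2)) (t : ℝ) : ℝ :=
  sInf (approxErrors v t)

theorem isLeast_psi (v : EuclideanSpace ℝ (Fin 2)) {t : ℝ} (ht : 1 ≤ t) :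
    IsLeast (approxErrors v t) (psi v t) := by
  have hfin : (approxErrors v t).Finite := by
    refine ((Set.finite_Iic ⌊t⌋₊).image fun q : ℕ =>
      Real.sqrt (distInt (q * v 0) ^ 2 + distInt (q * v 1) ^ 2)).subset ?_
    rintro r ⟨q, _, hq, rfl⟩
    exact ⟨q, Nat.le_floor hq, rfl⟩
  have hne : (approxErrors v t).Nonempty := ⟨_, 1, le_rfl, by simpa using ht, rfl⟩
  exact ⟨hne.csInf_mem hfin, fun r hr => csInf_le hfin.bddBelow hr⟩

/-- The two-dimensional Dirichlet spectrum in the Euclidean norm: the set of the real numbers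
`lam = limsup_{t → ∞} t · ψ_v(t)²`, `v ∈ ℝ²`. The upper limit, over real `t`, is taken in the
extended real line, where it always exists. -/
def dirichletSpectrum₂ : Set ℝ :=
  {lam | ∃ v : EuclideanSpace ℝ (Fin 2),
    Filter.limsup (fun t : ℝ => ((t * psi v t ^ 2 : ℝ) : EReal)) Filter.atTop = (lam : EReal)}

end DirichletSpectrum

/-! Upper bound. If ψ(t) = r > 0, the ⌊t⌋ + 1 > t points 0, v, …, ⌊t⌋v are r-separated on the torus
ℝ²/ℤ², so Thue's packing inequality (`card_mul_sq_le_one`) gives t · (√3/2) r² ≤ 1 for every t ≥ 1,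
not only in the limit. Thue's inequality comes from Voronoi cells truncated at radius R = r/√3
(`le_volume_voronoi`): each neighbour cuts a segment off the disc, which is at most the hexagonal
fraction of its sector, and sectors of different neighbours are disjoint.

Realisation of lam > 0. An integer vector x = (q, m, n) with q > 0 stands for the rational point (m,
n)/q, and ‖proj x u‖ is the error of u as an approximation to that point. These projections form a
plane lattice of covolume 1/q. If it is nearly similar to the lattice spanned by 1 and 1/2 + i/lam,
whose minimum is 1 exactly when lam ≤ 2/√3, then t · ψ(t)² is close to lam just before t = q. From
any basis of ℤ³, two continued fraction steps reach such a lattice at a rational point near the old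
one, and t · ψ² stays below lam + η on the way (`IsPosBasis.exists_two_steps`). The conditions are
open, so they hold on a small ball (`IsPosBasis.exists_closedBall_subset`); nested balls with η → 0
shrink onto a suitable v. The value 0 comes from v = 0. -/

namespace DirichletSpectrum
open MeasureTheory Set Filter Topology
open scoped ENNReal

/-! ### Areas of circular sectors and segments -/

/-- The open circular sector of radius `R` with axis `p` and half-angle `arccos (‖p‖ / (2 R))`. -/
def sector (R : ℝ) (p : ℂ) : Set ℂ :=
  {x | ‖x‖ < R ∧ ‖x‖ * ‖p‖ ^ 2 < 2 * R * inner ℝ p x}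

/-- The part of the open disc of radius `R` that is at least as near to `p` as to the centre. -/
def segment (R : ℝ) (p : ℂ) : Set ℂ :=
  {x | ‖x‖ < R ∧ ‖p‖ ^ 2 ≤ 2 * inner ℝ p x}

theorem measurableSet_sector (R : ℝ) (p : ℂ) : MeasurableSet (sector R p) := by
  have h1 : MeasurableSet {x : ℂ | ‖x‖ < R} := measurableSet_lt (by fun_prop) (by fun_prop)
  have h2 : MeasurableSet {x : ℂ | ‖x‖ * ‖p‖ ^ 2 < 2 * R * inner ℝ p x} :=
    measurableSet_lt (by fun_prop) (by fun_prop)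
  exact h1.inter h2

theorem measurableSet_segment (R : ℝ) (p : ℂ) : MeasurableSet (segment R p) := by
  have h1 : MeasurableSet {x : ℂ | ‖x‖ < R} := measurableSet_lt (by fun_prop) (by fun_prop)
  have h2 : MeasurableSet {x : ℂ | ‖p‖ ^ 2 ≤ 2 * inner ℝ p x} :=
    measurableSet_le (by fun_prop) (by fun_prop)
  exact h1.inter h2

theorem segment_subset_sector {R : ℝ} {p : ℂ} (hp : p ≠ 0) :
    segment R p ⊆ sector R p := by
  rintro x ⟨hx, h⟩
  refine ⟨hx, ?_⟩
  have hp' : 0 < ‖p‖ ^ 2 := by positivity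
  have hR : 0 < R := (norm_nonneg x).trans_lt hx
  nlinarith

/-- An upper bound for the area of a sector about the positive real axis. -/
theorem volume_sector_ofReal_le {R P : ℝ} (hP : 0 < P) (hPR : P < 2 * R) :
    volume (sector R (P : ℂ)) ≤ ENNReal.ofReal (Real.arccos (P / (2 * R)) * R ^ 2) := by
  have hR : 0 < R := by linarith
  set α := Real.arccos (P / (2 * R)) with hα
  have hα0 : 0 ≤ α := Real.arccos_nonneg _
  have hαπ : α ≤ Real.pi := Real.arccos_le_pi _
  rw [← lintegral_indicator_one (measurableSet_sector _ _),
    ← Complex.lintegral_comp_polarCoord_symm]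
  calc _ ≤ ∫⁻ p : ℝ × ℝ, (Ioo 0 R ×ˢ Ioo (-α) α).indicator (fun p => ENNReal.ofReal p.1) p := by
        rw [← lintegral_indicator (by exact polarCoord.open_target.measurableSet)]
        refine lintegral_mono fun p => ?_
        by_cases hp : p ∈ polarCoord.target
        · rw [indicator_of_mem hp]
          by_cases hs : Complex.polarCoord.symm p ∈ sector R (P : ℂ)
          · rw [indicator_of_mem hs, indicator_of_mem]
            · simp
            · obtain ⟨h1, h2⟩ := hs
              obtain ⟨hp1, hp2⟩ := hp
              simp only [mem_Ioi, mem_Ioo] at hp1 hp2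
              rw [Complex.norm_polarCoord_symm, abs_of_pos hp1] at h1 h2
              refine ⟨⟨hp1, h1⟩, ?_⟩
              have h3 : inner ℝ (P : ℂ) (Complex.polarCoord.symm p) = P * p.1 * Real.cos p.2 := by
                rw [Complex.inner, Complex.polarCoord_symm_apply]
                simp [Complex.cos_ofReal_re]
                ring
              rw [h3, Complex.norm_real, Real.norm_of_nonneg hP.le] at h2
              have h4 : P / (2 * R) < Real.cos p.2 := by
                rw [div_lt_iff₀ (by linarith)]
                have : 0 < p.1 * P := by positivity
                nlinarith
              have h5 : |p.2| < α := by
                rw [← Real.cos_abs] at h4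
                have := Real.arccos_lt_arccos (x := P / (2 * R)) (y := Real.cos |p.2|)
                  (by have : 0 < P / (2 * R) := by positivity
                      linarith) h4 (Real.cos_le_one _)
                rwa [Real.arccos_cos (abs_nonneg _) (abs_le.2 ⟨by linarith [hp2.1], by linarith [hp2.2]⟩)] at this
              exact abs_lt.1 h5
          · rw [indicator_of_notMem hs]; simp
        · rw [indicator_of_notMem hp]; simp
    _ = ∫⁻ p in Ioo (0 : ℝ) R ×ˢ Ioo (-α) α, ENNReal.ofReal p.1 := by
        rw [lintegral_indicator (measurableSet_Ioo.prod measurableSet_Ioo)]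
    _ = ENNReal.ofReal (α * R ^ 2) := by
        rw [Measure.volume_eq_prod, ← Measure.prod_restrict, lintegral_prod _ (by fun_prop)]
        simp only [lintegral_const, MeasurableSet.univ, Measure.restrict_apply, univ_inter,
          Real.volume_Ioo]
        rw [lintegral_mul_const _ (by fun_prop),
          ← ofReal_integral_eq_lintegral_ofReal]
        · rw [← integral_Ioc_eq_integral_Ioo, ← intervalIntegral.integral_of_le hR.le, integral_id,
            ← ENNReal.ofReal_mul (by have := sq_nonneg R; linarith)]
          congr 1
          ring
        · exact (continuous_id.integrableOn_Icc).mono_set Ioo_subset_Icc_self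
        · exact (ae_restrict_iff' measurableSet_Ioo).2 (.of_forall fun x hx => hx.1.le)

/-- The area of an isosceles triangle with apex `0` and altitude `d` on the real axis. -/
theorem volume_triangle {d m : ℝ} (hd : 0 ≤ d) (hm : 0 ≤ m) :
    volume {z : ℂ | z.re ∈ Ioo 0 d ∧ |z.im| < m * z.re} = ENNReal.ofReal (d ^ 2 * m) := by
  have h := Complex.volume_preserving_equiv_real_prod.symm.measure_preimage_equiv
    {z : ℂ | z.re ∈ Ioo 0 d ∧ |z.im| < m * z.re}
  rw [← h]
  have : Complex.measurableEquivRealProd.symm ⁻¹' {z : ℂ | z.re ∈ Ioo 0 d ∧ |z.im| < m * z.re}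
      = regionBetween (fun x => -(m * x)) (fun x => m * x) (Ioo 0 d) := by
    ext ⟨x, y⟩
    simp [regionBetween, abs_lt, Complex.measurableEquivRealProd_symm_apply]
  rw [this, Measure.volume_eq_prod, volume_regionBetween_eq_integral
    (((by fun_prop : Continuous fun x => -(m * x)).integrableOn_Icc).mono_set Ioo_subset_Icc_self)
    (((by fun_prop : Continuous fun x => m * x).integrableOn_Icc).mono_set Ioo_subset_Icc_self)
    measurableSet_Ioo]
  · congr 1
    rw [← integral_Ioc_eq_integral_Ioo, ← intervalIntegral.integral_of_le hd]
    have : ∀ y, ((fun x => m * x) - fun x => -(m * x)) y = (2 * m) * y := fun y => by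
      simp; ring
    simp_rw [this]
    rw [intervalIntegral.integral_const_mul, integral_id]
    ring
  · intro x hx
    have := mul_nonneg hm hx.1.le
    linarith

/-- With c = cos α the right side is sin 2α / 2. Since 2α lies in [0, π/3], concavity puts the sine
above its chord there; equality holds at α = π/6, the hexagonal case. -/
theorem chord_le_mul_sqrt_one_sub_sq {c : ℝ} (h1 : Real.sqrt 3 / 2 ≤ c) (h2 : c ≤ 1) :
    3 * Real.sqrt 3 / (2 * Real.pi) * Real.arccos c ≤ c * Real.sqrt (1 - c ^ 2) := by
  have hs : 0 < Real.sqrt 3 := by positivity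
  set α := Real.arccos c with hα
  have hα0 : 0 ≤ α := Real.arccos_nonneg _
  have hα1 : α ≤ Real.pi / 6 := by
    rw [← Real.arccos_cos (x := Real.pi / 6) (by positivity) (by linarith [Real.pi_pos]),
      Real.cos_pi_div_six]
    exact Real.antitone_arccos h1
  rw [← Real.sin_arccos, ← hα]
  have hcos : c = Real.cos α := (Real.cos_arccos (by linarith) h2).symm
  rw [hcos]
  have hpi := Real.pi_pos
  have h3 := strictConcaveOn_sin_Icc.concaveOn.2
    (show (0 : ℝ) ∈ Icc 0 Real.pi from ⟨le_rfl, hpi.le⟩)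
    (show Real.pi / 3 ∈ Icc 0 Real.pi from ⟨by positivity, by linarith⟩)
    (show 0 ≤ 1 - 6 * α / Real.pi by rw [sub_nonneg, div_le_one hpi]; linarith)
    (show 0 ≤ 6 * α / Real.pi by positivity) (by ring)
  simp only [smul_eq_mul, Real.sin_zero, mul_zero, zero_add, Real.sin_pi_div_three] at h3
  have h4 : 6 * α / Real.pi * (Real.pi / 3) = 2 * α := by field_simp; ring
  rw [h4, Real.sin_two_mul] at h3
  have h5 : 3 * Real.sqrt 3 / (2 * Real.pi) * α = 6 * α / Real.pi * (Real.sqrt 3 / 2) / 2 := by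
    field_simp; ring
  linarith

/-- The sector contains the segment and, disjoint from it, the open triangle `T` under the chord.
The triangle has at least the fraction 3√3/(2π) of the sector's area, so upper bounds for the sector
suffice and the segment's area is never computed. -/
theorem volume_segment_ofReal_le {R P : ℝ} (hR : 0 < R) (h1 : Real.sqrt 3 * R ≤ P)
    (h2 : P < 2 * R) :
    volume (segment R (P : ℂ)) ≤
      ENNReal.ofReal (1 - 3 * Real.sqrt 3 / (2 * Real.pi)) * volume (sector R (P : ℂ)) := by
  have hs : 0 < Real.sqrt 3 := by positivity
  have hP : 0 < P := by nlinarith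
  set c := P / (2 * R) with hc
  have hc0 : 0 < c := by positivity
  have hPc : P = 2 * R * c := by rw [hc]; field_simp
  have hc1 : Real.sqrt 3 / 2 ≤ c := by rw [hc, le_div_iff₀ (by positivity)]; linarith
  have hc2 : c < 1 := by rw [hc, div_lt_one (by positivity)]; exact h2
  have hsec := volume_sector_ofReal_le hP h2
  rw [← hc] at hsec
  set s := Real.sqrt (1 - c ^ 2) with hs'
  have hs2 : s ^ 2 = 1 - c ^ 2 := Real.sq_sqrt (by nlinarith)
  have hs0 : 0 ≤ s := Real.sqrt_nonneg _
  set k := 3 * Real.sqrt 3 / (2 * Real.pi) with hk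
  have hk0 : 0 ≤ k := by positivity
  have htri := volume_triangle (d := R * c) (m := s / c) (by positivity) (by positivity)
  set T := {z : ℂ | z.re ∈ Ioo 0 (R * c) ∧ |z.im| < s / c * z.re} with hT
  have hinner : ∀ z : ℂ, inner ℝ (P : ℂ) z = P * z.re := fun z => by
    simp [Complex.inner, mul_comm]
  have hnorm : ‖(P : ℂ)‖ = P := by rw [Complex.norm_real, Real.norm_of_nonneg hP.le]
  have hTsub : T ⊆ sector R (P : ℂ) := by
    rintro z ⟨⟨hz1, hz2⟩, hz3⟩
    rw [div_mul_eq_mul_div, lt_div_iff₀ hc0] at hz3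
    have hz4 : ‖z‖ * c < z.re := by
      refine lt_of_pow_lt_pow_left₀ 2 hz1.le ?_
      rw [mul_pow, Complex.sq_norm, Complex.normSq_apply]
      have h5 : (|z.im| * c) ^ 2 < (s * z.re) ^ 2 :=
        pow_lt_pow_left₀ hz3 (by positivity) two_ne_zero
      rw [mul_pow, mul_pow, sq_abs, hs2] at h5
      nlinarith
    refine ⟨?_, ?_⟩
    · have : ‖z‖ * c < R * c := hz4.trans hz2
      exact lt_of_mul_lt_mul_right this hc0.le
    · rw [hinner, hnorm, hPc]
      have : 0 < 2 * R * c * (2 * R) := by positivity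
      nlinarith
  have hdisj : Disjoint (segment R (P : ℂ)) T := by
    rw [Set.disjoint_left]
    rintro z ⟨-, hz⟩ ⟨⟨-, hz2⟩, -⟩
    rw [hinner, hnorm] at hz
    have : P ≤ 2 * z.re := by nlinarith
    linarith
  have hadd : volume (segment R (P : ℂ)) + volume T ≤ volume (sector R (P : ℂ)) := by
    rw [← measure_union' hdisj (measurableSet_segment _ _)]
    exact measure_mono (union_subset (segment_subset_sector (by exact_mod_cast hP.ne')) hTsub)
  have hfin : volume (sector R (P : ℂ)) ≠ ∞ := (hsec.trans_lt ENNReal.ofReal_lt_top).ne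
  obtain ⟨S, hS⟩ : ∃ S : ℝ, volume (sector R (P : ℂ)) = ENNReal.ofReal S ∧ 0 ≤ S :=
    ⟨_, (ENNReal.ofReal_toReal hfin).symm, ENNReal.toReal_nonneg⟩
  have hGfin : volume (segment R (P : ℂ)) ≠ ∞ :=
    ((le_self_add.trans hadd).trans_lt hfin.lt_top).ne
  obtain ⟨G, hG⟩ : ∃ G : ℝ, volume (segment R (P : ℂ)) = ENNReal.ofReal G ∧ 0 ≤ G :=
    ⟨_, (ENNReal.ofReal_toReal hGfin).symm, ENNReal.toReal_nonneg⟩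
  rw [hS.1, hG.1, htri, ← ENNReal.ofReal_add hG.2 (by positivity),
    ENNReal.ofReal_le_ofReal_iff hS.2] at hadd
  rw [hS.1, ENNReal.ofReal_le_ofReal_iff (mul_nonneg (Real.arccos_nonneg c) (sq_nonneg R))] at hsec
  rw [hS.1, hG.1, ← ENNReal.ofReal_mul' hS.2]
  refine ENNReal.ofReal_le_ofReal ?_
  have hch := chord_le_mul_sqrt_one_sub_sq hc1 hc2.le
  rw [← hk, ← hs'] at hch
  have e1 : (R * c) ^ 2 * (s / c) = R ^ 2 * (c * s) := by field_simp
  rw [e1] at hadd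
  have e2 : R ^ 2 * (k * Real.arccos c) ≤ R ^ 2 * (c * s) := by gcongr
  have e3 : k * S ≤ k * (Real.arccos c * R ^ 2) := by gcongr
  linarith

theorem volume_segment_le {R : ℝ} {p : ℂ} (hR : 0 < R) (h1 : Real.sqrt 3 * R ≤ ‖p‖) :
    volume (segment R p) ≤
      ENNReal.ofReal (1 - 3 * Real.sqrt 3 / (2 * Real.pi)) * volume (sector R p) := by
  rcases lt_or_ge ‖p‖ (2 * R) with h2 | h2
  · have hs : 0 < Real.sqrt 3 := by positivity
    have hp : 0 < ‖p‖ := by nlinarith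
    have hp0 : (‖p‖ : ℂ) ≠ 0 := by exact_mod_cast hp.ne'
    obtain ⟨u, hu⟩ : ∃ u : Circle, rotation u (‖p‖ : ℂ) = p := by
      have hn : ‖p / (‖p‖ : ℂ)‖ = 1 := by
        rw [norm_div, Complex.norm_real, norm_norm, div_self hp.ne']
      exact ⟨⟨p / ‖p‖, mem_sphere_zero_iff_norm.2 hn⟩, div_mul_cancel₀ p hp0⟩
    have hmp : MeasurePreserving (rotation u) volume volume :=
      (rotation u).measurePreserving
    have hn : ∀ x, ‖rotation u x‖ = ‖x‖ := (rotation u).norm_map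
    have hi : ∀ x, inner ℝ p (rotation u x) = inner ℝ (‖p‖ : ℂ) x := fun x => by
      conv_lhs => rw [← hu]
      exact (rotation u).inner_map_map _ _
    have e1 : rotation u ⁻¹' segment R p = segment R (‖p‖ : ℂ) := by
      ext x; simp only [segment, mem_preimage, mem_ofPred_eq, hn, hi, Complex.norm_real, norm_norm]
    have e2 : rotation u ⁻¹' sector R p = sector R (‖p‖ : ℂ) := by
      ext x; simp only [sector, mem_preimage, mem_ofPred_eq, hn, hi, Complex.norm_real, norm_norm]
    rw [← hmp.measure_preimage (measurableSet_segment _ _).nullMeasurableSet,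
      ← hmp.measure_preimage (measurableSet_sector _ _).nullMeasurableSet, e1, e2]
    exact volume_segment_ofReal_le hR h1 h2
  · have : segment R p = ∅ := by
      ext x
      simp only [segment, mem_ofPred_eq, mem_empty_iff_false, iff_false, not_and, not_le]
      intro hx
      have := real_inner_le_norm p x
      nlinarith [norm_nonneg x]
    simp [this]

/-! ### Thue's inequality by truncated Voronoi cells -/

/-- Three points with mutual distances at least `√3 R` do not lie in the interior of a disc of
radius `R`, even if one of them is allowed on the boundary. -/
theorem not_norm_sub_lt_of_separated {R : ℝ} {x p q : ℂ} (hR : 0 < R) (hx : ‖x‖ ≤ R)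
    (hp : Real.sqrt 3 * R ≤ ‖p‖) (hq : Real.sqrt 3 * R ≤ ‖q‖) (hpq : Real.sqrt 3 * R ≤ ‖p - q‖)
    (hxp : ‖x - p‖ < R) (hxq : ‖x - q‖ < R) : False := by
  have h3 : (Real.sqrt 3 * R) ^ 2 = 3 * R ^ 2 := by
    rw [mul_pow, Real.sq_sqrt (by norm_num)]
  have hs : 0 ≤ Real.sqrt 3 * R := by positivity
  have e1 := pow_le_pow_left₀ hs hp 2
  have e2 := pow_le_pow_left₀ hs hq 2
  have e3 := pow_le_pow_left₀ hs hpq 2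
  have e4 := pow_le_pow_left₀ (norm_nonneg _) hx 2
  have e5 := pow_lt_pow_left₀ hxp (norm_nonneg _) two_ne_zero
  have e6 := pow_lt_pow_left₀ hxq (norm_nonneg _) two_ne_zero
  rw [h3] at e1 e2 e3
  simp only [Complex.sq_norm, Complex.normSq_apply, Complex.sub_re, Complex.sub_im] at *
  -- With centroid g = (p + q)/3 of 0, p, q: |x|² + |x − p|² + |x − q|² = 3|x − g|² + (|p|² + |q|² +
  -- |p − q|²)/3 ≥ 3R², while the left side is below 3R².
  nlinarith [sq_nonneg (3 * x.re - p.re - q.re), sq_nonneg (3 * x.im - p.im - q.im)]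

/-- A common point can be pushed radially onto the circle of radius R, where lying in the sector of
p means being nearer than R to p. -/
theorem disjoint_sector {R : ℝ} {p q : ℂ} (hR : 0 < R)
    (hp : Real.sqrt 3 * R ≤ ‖p‖) (hq : Real.sqrt 3 * R ≤ ‖q‖) (hpq : Real.sqrt 3 * R ≤ ‖p - q‖) :
    Disjoint (sector R p) (sector R q) := by
  rw [Set.disjoint_left]
  rintro x ⟨-, hxp⟩ ⟨-, hxq⟩
  have hx : 0 < ‖x‖ := by
    rw [norm_pos_iff]
    rintro rfl
    simp at hxp
  have hx0 : ‖x‖ ≠ 0 := hx.ne'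
  set y : ℂ := (R / ‖x‖ : ℝ) • x with hy
  have hyR : ‖y‖ = R := by
    rw [hy, norm_smul, Real.norm_of_nonneg (by positivity)]
    field_simp
  have key : ∀ a : ℂ, ‖x‖ * ‖a‖ ^ 2 < 2 * R * inner ℝ a x → ‖y - a‖ < R := by
    intro a ha
    refine lt_of_pow_lt_pow_left₀ 2 hR.le ?_
    have h1 : inner ℝ y a = R / ‖x‖ * inner ℝ a x := by
      rw [hy, inner_smul_left, real_inner_comm]; rfl
    have h2 : ‖a‖ ^ 2 < 2 * (R / ‖x‖ * inner ℝ a x) := by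
      rw [show 2 * (R / ‖x‖ * inner ℝ a x) = 2 * R * inner ℝ a x / ‖x‖ by ring, lt_div_iff₀ hx]
      linarith
    have := norm_sub_sq_real y a
    rw [this, h1, hyR]
    linarith
  exact not_norm_sub_lt_of_separated hR hyR.le hp hq hpq (key p hxp) (key q hxq)

/-- The truncated Voronoi cell of `0` in a `√3 R`-separated set is at least as large as a regular
hexagon of circumradius `R`. -/
theorem le_volume_voronoi {R : ℝ} (hR : 0 < R) {S : Set ℂ} (hS : S.Countable)
    (h0 : ∀ p ∈ S, Real.sqrt 3 * R ≤ ‖p‖)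
    (hsep : ∀ p ∈ S, ∀ q ∈ S, p ≠ q → Real.sqrt 3 * R ≤ ‖p - q‖) :
    ENNReal.ofReal (3 * Real.sqrt 3 / 2 * R ^ 2) ≤
      volume (Metric.ball 0 R \ ⋃ p ∈ S, segment R p) := by
  have hpi := Real.pi_pos
  set c := 1 - 3 * Real.sqrt 3 / (2 * Real.pi) with hc
  have hc0 : 0 ≤ c := by
    rw [hc, sub_nonneg, div_le_one (by positivity)]
    have : Real.sqrt 3 ≤ 2 := Real.sqrt_le_iff.2 ⟨by norm_num, by norm_num⟩
    linarith [Real.pi_gt_three]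
  have hball : volume (Metric.ball (0 : ℂ) R) = ENNReal.ofReal (Real.pi * R ^ 2) := by
    rw [Complex.volume_ball, mul_comm, ENNReal.ofReal_mul hpi.le, ENNReal.ofReal_pow hR.le]
    congr 1
    rw [← NNReal.coe_real_pi, ENNReal.ofReal_coe_nnreal]
  -- Each segment takes at most the fraction c of its sector, and the disjoint sectors share the
  -- disc.
  have hU : volume (⋃ p ∈ S, segment R p) ≤ ENNReal.ofReal (c * (Real.pi * R ^ 2)) := by
    calc volume (⋃ p ∈ S, segment R p) ≤ ∑' p : S, volume (segment R (p : ℂ)) :=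
          measure_biUnion_le _ hS _
      _ ≤ ∑' p : S, ENNReal.ofReal c * volume (sector R (p : ℂ)) :=
          ENNReal.tsum_le_tsum fun p => volume_segment_le hR (h0 p p.2)
      _ = ENNReal.ofReal c * volume (⋃ p ∈ S, sector R p) := by
          rw [ENNReal.tsum_mul_left, measure_biUnion hS]
          · intro p hp q hq hpq
            exact disjoint_sector hR (h0 p hp) (h0 q hq) (hsep p hp q hq hpq)
          · exact fun p _ => measurableSet_sector R p
      _ ≤ ENNReal.ofReal c * volume (Metric.ball (0 : ℂ) R) := by
          gcongr
          refine iUnion₂_subset fun p _ x hx => ?_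
          simpa using hx.1
      _ = _ := by rw [hball, ENNReal.ofReal_mul hc0]
  refine le_trans ?_ (le_measure_sdiff)
  rw [hball]
  refine le_trans ?_ (tsub_le_tsub_left hU _)
  rw [← ENNReal.ofReal_sub _ (by positivity)]
  refine ENNReal.ofReal_le_ofReal (le_of_eq ?_)
  rw [hc]
  field_simp
  ring

theorem volume_fundamentalDomain_basisOneI :
    volume (ZSpan.fundamentalDomain Complex.basisOneI) = 1 := by
  rw [← Complex.toBasis_orthonormalBasisOneI,
    measure_congr (ZSpan.fundamentalDomain_ae_parallelepiped _ volume)]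
  exact Complex.orthonormalBasisOneI.volume_parallelepiped

theorem mem_span_basisOneI {a : ℂ} (ha : a ∈ Submodule.span ℤ (range Complex.basisOneI)) :
    ∃ m n : ℤ, a = ⟨m, n⟩ := by
  rw [Complex.coe_basisOneI, Matrix.range_cons, Matrix.range_cons, Matrix.range_empty,
    union_empty, singleton_union, Submodule.mem_span_pair] at ha
  obtain ⟨m, n, rfl⟩ := ha
  exact ⟨m, n, by apply Complex.ext <;> simp⟩

/-- Thue's inequality for periodic packings: `card ι` points of the torus `ℂ / ℤ[i]` with mutual
distances at least `r` satisfy `card ι · (√3 / 2) r² ≤ 1`. -/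
theorem card_mul_sq_le_one {ι : Type*} [Fintype ι] (x : ι → ℂ) {r : ℝ} (hr : 0 < r)
    (hsep : ∀ i j, ∀ m n : ℤ, (i ≠ j ∨ m ≠ 0 ∨ n ≠ 0) → r ≤ ‖x i - (x j + ⟨m, n⟩)‖) :
    Fintype.card ι * (Real.sqrt 3 / 2 * r ^ 2) ≤ 1 := by
  classical
  have hs : 0 < Real.sqrt 3 := by positivity
  have hs2 : Real.sqrt 3 ^ 2 = 3 := Real.sq_sqrt (by norm_num)
  set R := r / Real.sqrt 3 with hR
  have hR0 : 0 < R := by positivity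
  have hRr : Real.sqrt 3 * R = r := by rw [hR]; field_simp
  -- All other points of the periodic set, as seen from `x i`.
  let S : ι → Set ℂ := fun i =>
    (fun t : ι × ℤ × ℤ => x t.1 + ⟨t.2.1, t.2.2⟩ - x i) '' {t | t ≠ (i, 0, 0)}
  let C : ι → Set ℂ := fun i => Metric.ball 0 R \ ⋃ p ∈ S i, segment R p
  have hScount : ∀ i, (S i).Countable := fun i => (to_countable _).image _
  have hne : ∀ {i j : ι} {m n : ℤ}, (i, m, n) ≠ (j, 0, 0) → i ≠ j ∨ m ≠ 0 ∨ n ≠ 0 := by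
    intro i j m n h
    by_contra! h'
    exact h (by rw [h'.1, h'.2.1, h'.2.2])
  have hCm : ∀ i, MeasurableSet (C i) := fun i =>
    Metric.isOpen_ball.measurableSet.diff
      (.biUnion (hScount i) fun p _ => measurableSet_segment R p)
  have hCvol : ∀ i, ENNReal.ofReal (Real.sqrt 3 / 2 * r ^ 2) ≤ volume (C i) := by
    intro i
    have e : Real.sqrt 3 / 2 * r ^ 2 = 3 * Real.sqrt 3 / 2 * R ^ 2 := by
      rw [← hRr, mul_pow, hs2]; ring
    rw [e]
    refine le_volume_voronoi hR0 (hScount i) ?_ ?_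
    · rintro _ ⟨⟨j, m, n⟩, ht, rfl⟩
      rw [hRr, norm_sub_rev]
      exact hsep i j m n ((hne ht).imp_left Ne.symm)
    · rintro _ ⟨⟨j, m, n⟩, -, rfl⟩ _ ⟨⟨j', m', n'⟩, -, rfl⟩ h
      have h' : j ≠ j' ∨ m' - m ≠ 0 ∨ n' - n ≠ 0 := by
        by_contra! h'
        apply h
        obtain ⟨rfl, h1, h2⟩ := h'
        rw [sub_eq_zero] at h1 h2
        simp [h1, h2]
      have := hsep j j' _ _ h'
      rw [hRr]
      convert this using 2
      apply Complex.ext <;> simp <;> ring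
  -- a point of a translated cell is nearer to its centre than to any other point
  have hnear : ∀ i z, z - x i ∈ C i → ∀ j, ∀ m n : ℤ, (j ≠ i ∨ m ≠ 0 ∨ n ≠ 0) →
      ‖z - x i‖ < ‖z - (x j + ⟨m, n⟩)‖ := by
    rintro i z ⟨hz1, hz2⟩ j m n h
    rw [mem_ball_zero_iff] at hz1
    set p : ℂ := x j + ⟨m, n⟩ - x i with hp
    have hpS : p ∈ S i := ⟨(j, m, n), by
      intro h'
      simp only [Prod.mk.injEq] at h'
      rcases h with h | h | h
      exacts [h h'.1, h h'.2.1, h h'.2.2], rfl⟩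
    have hseg : z - x i ∉ segment R p := fun h' => hz2 (mem_biUnion hpS h')
    have hin : 2 * inner ℝ p (z - x i) < ‖p‖ ^ 2 := by
      by_contra! h'
      exact hseg ⟨hz1, h'⟩
    have e : z - (x j + ⟨m, n⟩) = (z - x i) - p := by rw [hp]; ring
    refine lt_of_pow_lt_pow_left₀ 2 (norm_nonneg _) ?_
    rw [e, norm_sub_sq_real (z - x i) p, real_inner_comm]
    linarith
  let D : ι → Set ℂ := fun i => (fun z => z - x i) ⁻¹' C i
  have hDm : ∀ i, MeasurableSet (D i) := fun i => (hCm i).preimage (by fun_prop)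
  have hDdisj : ∀ i j : ι, ∀ a b : Submodule.span ℤ (range Complex.basisOneI), (i ≠ j ∨ a ≠ b) →
      ∀ z, z - (a : ℂ) ∈ D i → z - (b : ℂ) ∈ D j → False := by
    intro i j a b hab z h1 h2
    obtain ⟨m, n, hmn⟩ := mem_span_basisOneI (sub_mem b.2 a.2)
    have h' : j ≠ i ∨ m ≠ 0 ∨ n ≠ 0 := by
      rcases hab with h | h
      · exact .inl h.symm
      · by_contra! h'
        rw [h'.2.1, h'.2.2] at hmn
        apply h
        apply Subtype.ext
        refine (sub_eq_zero.1 (hmn.trans ?_)).symm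
        simp [Complex.ext_iff]
    have n1 := hnear i _ h1 j m n h'
    have n2 := hnear j _ h2 i (-m) (-n) (by
      rcases h' with h | h | h
      exacts [.inl h.symm, .inr (.inl (neg_ne_zero.2 h)), .inr (.inr (neg_ne_zero.2 h))])
    have hneg : (⟨((-m : ℤ) : ℝ), ((-n : ℤ) : ℝ)⟩ : ℂ) = -⟨m, n⟩ := by
      apply Complex.ext <;> simp
    rw [hneg, ← hmn] at n2
    rw [← hmn] at n1
    rw [show z - (a : ℂ) - (x j + (b - a)) = z - b - x j by ring] at n1
    rw [show z - (b : ℂ) - (x i + -(b - a)) = z - a - x i by ring] at n2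
    -- z would be strictly nearer to each of two centres than to the other. The weak inequality in
    -- `segment` makes the cells disjoint outright, not just up to measure zero.
    exact lt_asymm n1 n2
  -- Blichfeldt's principle: a set of area greater than the covolume 1 meets one of its nontrivial
  -- lattice translates.
  have hle : volume (⋃ i, D i) ≤ 1 := by
    by_contra! h
    rw [← volume_fundamentalDomain_basisOneI] at h
    have : Countable (Submodule.span ℤ (range Complex.basisOneI)).toAddSubgroup :=
      inferInstanceAs <| Countable (Submodule.span ℤ (range Complex.basisOneI))
    obtain ⟨a, b, hab, hnd⟩ := exists_pair_mem_lattice_not_disjoint_vadd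
      (ZSpan.isAddFundamentalDomain' Complex.basisOneI volume)
      (MeasurableSet.iUnion hDm).nullMeasurableSet h
    obtain ⟨z, hz1, hz2⟩ := Set.not_disjoint_iff.1 hnd
    obtain ⟨z1, hz1', rfl⟩ := hz1
    obtain ⟨z2, hz2', hz⟩ := hz2
    obtain ⟨i, hi⟩ := mem_iUnion.1 hz1'
    obtain ⟨j, hj⟩ := mem_iUnion.1 hz2'
    change (b : ℂ) + z2 = (a : ℂ) + z1 at hz
    refine hDdisj i j ⟨a, a.2⟩ ⟨b, b.2⟩ (.inr fun h => hab (Subtype.ext (Subtype.ext_iff.1 h)))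
      ((a : ℂ) + z1) (by simpa using hi) ?_
    rw [← hz]
    simpa using hj
  rw [measure_iUnion (fun i j hij => Set.disjoint_left.2 fun z h1 h2 =>
    hDdisj i j 0 0 (.inl hij) z (by simpa using h1) (by simpa using h2)) hDm,
    tsum_fintype] at hle
  have hsum : ∑ i : ι, ENNReal.ofReal (Real.sqrt 3 / 2 * r ^ 2) ≤ 1 := by
    refine (Finset.sum_le_sum fun i _ => ?_).trans hle
    have : volume (D i) = volume (C i) := by
      simp only [D, sub_eq_add_neg]
      exact measure_preimage_add_right volume (-x i) (C i)
    rw [this]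
    exact hCvol i
  rw [Finset.sum_const, Finset.card_univ, nsmul_eq_mul, ← ENNReal.ofReal_natCast,
    ← ENNReal.ofReal_mul (by positivity), ENNReal.ofReal_le_one] at hsum
  exact hsum

/-! ### The function ψ: upper bound, the value 0, a membership criterion -/

/-- The point of the complex plane with the coordinates of `v`. -/
noncomputable def toComplex (v : EuclideanSpace ℝ (Fin 2)) : ℂ :=
  ⟨v 0, v 1⟩

theorem norm_mul_toComplex_sub (v : EuclideanSpace ℝ (Fin 2)) (q : ℕ) (m n : ℤ) :
    ‖(q : ℂ) * toComplex v - ⟨m, n⟩‖ = Real.sqrt (|q * v 0 - m| ^ 2 + |q * v 1 - n| ^ 2) := by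
  rw [Complex.norm_def, Complex.normSq_apply]
  simp [toComplex, sq]

theorem psi_le (v : EuclideanSpace ℝ (Fin 2)) {t : ℝ} {q : ℕ} (hq : 1 ≤ q) (hqt : (q : ℝ) ≤ t)
    (m n : ℤ) : psi v t ≤ ‖(q : ℂ) * toComplex v - ⟨m, n⟩‖ := by
  have ht : 1 ≤ t := le_trans (by exact_mod_cast hq) hqt
  refine ((isLeast_psi v ht).2 ⟨q, hq, hqt, rfl⟩).trans ?_
  rw [norm_mul_toComplex_sub]
  have h0 : ∀ x, 0 ≤ distInt x := fun x => abs_nonneg _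
  refine Real.sqrt_le_sqrt (add_le_add ?_ ?_)
  · exact pow_le_pow_left₀ (h0 _) ((isLeast_distInt _).2 ⟨m, rfl⟩) 2
  · exact pow_le_pow_left₀ (h0 _) ((isLeast_distInt _).2 ⟨n, rfl⟩) 2

theorem exists_psi_eq (v : EuclideanSpace ℝ (Fin 2)) {t : ℝ} (ht : 1 ≤ t) :
    ∃ q : ℕ, 1 ≤ q ∧ (q : ℝ) ≤ t ∧ ∃ m n : ℤ,
      psi v t = ‖(q : ℂ) * toComplex v - ⟨m, n⟩‖ := by
  obtain ⟨q, hq, hqt, h⟩ := (isLeast_psi v ht).1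
  exact ⟨q, hq, hqt, round (q * v 0), round (q * v 1), by rw [h, norm_mul_toComplex_sub]; rfl⟩

theorem psi_nonneg (v : EuclideanSpace ℝ (Fin 2)) (t : ℝ) : 0 ≤ psi v t := by
  refine Real.sInf_nonneg ?_
  rintro _ ⟨q, -, -, rfl⟩
  exact Real.sqrt_nonneg _

theorem psi_le_one (v : EuclideanSpace ℝ (Fin 2)) {t : ℝ} (ht : 1 ≤ t) : psi v t ≤ 1 := by
  refine ((isLeast_psi v ht).2 ⟨1, le_rfl, by simpa using ht, rfl⟩).trans ?_
  refine Real.sqrt_le_iff.2 ⟨zero_le_one, ?_⟩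
  have h : ∀ x, distInt x ^ 2 ≤ (1 / 2) ^ 2 := fun x =>
    pow_le_pow_left₀ (abs_nonneg _) (abs_sub_round x) 2
  exact (add_le_add (h _) (h _)).trans (by norm_num)

/-- The upper bound for the Dirichlet spectrum, uniformly in `t`. -/
theorem mul_psi_sq_le (v : EuclideanSpace ℝ (Fin 2)) {t : ℝ} (ht : 1 ≤ t) :
    t * psi v t ^ 2 ≤ 2 / Real.sqrt 3 := by
  have hs : 0 < Real.sqrt 3 := by positivity
  rcases (psi_nonneg v t).eq_or_lt with h0 | h0
  · rw [← h0]; simp; positivity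
  -- The difference of two multiples of v is (i − j)v with 1 ≤ i − j ≤ t. A single multiple is at
  -- distance at least 1 ≥ ψ(t) from its own translates.
  have hsep : ∀ i j : ℕ, i ≤ ⌊t⌋₊ → j < i → ∀ m n : ℤ,
      psi v t ≤ ‖(i : ℂ) * toComplex v - (j * toComplex v + ⟨m, n⟩)‖ := by
    intro i j hi hj m n
    have := psi_le v (t := t) (q := i - j) (by omega)
      (le_trans (by exact_mod_cast (by omega : i - j ≤ ⌊t⌋₊)) (Nat.floor_le (by linarith))) m n
    rwa [Nat.cast_sub hj.le, sub_mul, sub_sub] at this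
  have h := card_mul_sq_le_one (fun i : Fin (⌊t⌋₊ + 1) => ((i : ℕ) : ℂ) * toComplex v) h0 (by
    intro i j m n h
    rcases lt_trichotomy i j with hij | rfl | hij
    · have := hsep j i (by omega) hij (-m) (-n)
      rw [← norm_neg]
      refine this.trans_eq (congrArg _ ?_)
      apply Complex.ext <;> simp <;> ring
    · refine (psi_le_one v ht).trans ?_
      rw [sub_add_cancel_left, norm_neg]
      rcases h with h | h | h
      · exact absurd rfl h
      · refine le_trans ?_ (Complex.abs_re_le_norm _)
        change (1 : ℝ) ≤ |(m : ℝ)|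
        exact_mod_cast Int.one_le_abs h
      · refine le_trans ?_ (Complex.abs_im_le_norm _)
        change (1 : ℝ) ≤ |(n : ℝ)|
        exact_mod_cast Int.one_le_abs h
    · exact hsep i j (by omega) hij m n)
  rw [Fintype.card_fin, Nat.cast_add_one] at h
  rw [le_div_iff₀ hs]
  have := Nat.lt_floor_add_one t
  have h1 : t * (Real.sqrt 3 / 2 * psi v t ^ 2) ≤ (⌊t⌋₊ + 1) * (Real.sqrt 3 / 2 * psi v t ^ 2) := by
    gcongr
  linarith

theorem dirichletSpectrum₂_subset : dirichletSpectrum₂ ⊆ Icc 0 (2 / Real.sqrt 3) := by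
  rintro lam ⟨v, hv⟩
  have h1 : (lam : EReal) ≤ ((2 / Real.sqrt 3 : ℝ) : EReal) := by
    rw [← hv]
    refine Filter.limsup_le_of_le (h := ?_)
    filter_upwards [Filter.eventually_ge_atTop (1 : ℝ)] with t ht
    exact EReal.coe_le_coe_iff.2 (mul_psi_sq_le v ht)
  have h0 : ((0 : ℝ) : EReal) ≤ lam := by
    rw [← hv]
    refine Filter.le_limsup_of_frequently_le (Filter.Eventually.frequently ?_)
    filter_upwards [Filter.eventually_ge_atTop (0 : ℝ)] with t ht
    exact EReal.coe_le_coe_iff.2 (by positivity)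
  exact ⟨EReal.coe_le_coe_iff.1 h0, EReal.coe_le_coe_iff.1 h1⟩

theorem zero_mem_dirichletSpectrum₂ : (0 : ℝ) ∈ dirichletSpectrum₂ := by
  refine ⟨0, ?_⟩
  rw [Filter.limsup_congr (v := fun _ => ((0 : ℝ) : EReal)), Filter.limsup_const]
  filter_upwards [Filter.eventually_ge_atTop (1 : ℝ)] with t ht
  have h := psi_le (0 : EuclideanSpace ℝ (Fin 2)) (q := 1) le_rfl (by simpa using ht) 0 0
  have h0 : ‖((1 : ℕ) : ℂ) * toComplex 0 - ⟨(0 : ℤ), (0 : ℤ)⟩‖ = 0 := by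
    rw [norm_mul_toComplex_sub]; simp
  rw [h0] at h
  rw [le_antisymm h (psi_nonneg _ _)]
  simp

/-- A criterion for `lam` to be the upper limit that defines the spectrum. -/
theorem mem_dirichletSpectrum₂_of_forall_eventually {lam : ℝ} (v : EuclideanSpace ℝ (Fin 2))
    (hle : ∀ η > 0, ∀ᶠ t : ℝ in Filter.atTop, t * psi v t ^ 2 ≤ lam + η)
    (hge : ∀ η > 0, ∃ᶠ t : ℝ in Filter.atTop, lam - η ≤ t * psi v t ^ 2) :
    lam ∈ dirichletSpectrum₂ := by
  refine ⟨v, le_antisymm ?_ ?_⟩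
  · refine EReal.le_of_forall_lt_iff_le.1 fun z hz => ?_
    have hz' : lam < z := EReal.coe_lt_coe_iff.1 hz
    refine Filter.limsup_le_of_le (h := ?_)
    filter_upwards [hle (z - lam) (by linarith)] with t ht
    exact EReal.coe_le_coe_iff.2 (by linarith)
  · refine EReal.ge_of_forall_gt_iff_ge.1 fun z hz => ?_
    have hz' : z < lam := EReal.coe_lt_coe_iff.1 hz
    refine Filter.le_limsup_of_frequently_le ((hge (lam - z) (by linarith)).mono fun t ht => ?_)
    exact EReal.coe_le_coe_iff.2 (by linarith)

/-! ### Bases of ℤ³ and their projected lattices -/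

/-- The last two coordinates of an integer vector, as a point of the complex plane. -/
noncomputable def planePart (x : Fin 3 → ℤ) : ℂ :=
  ⟨x 1, x 2⟩

/-- The rational point of the plane given by an integer vector in homogeneous coordinates. -/
noncomputable def center (x : Fin 3 → ℤ) : ℂ :=
  planePart x / x 0

/-- The projection of `y` along `x` to the plane of the last two coordinates. -/
noncomputable def proj (x y : Fin 3 → ℤ) : ℂ :=
  planePart y - y 0 * center x

/-- `x, y, z` is a positively oriented basis of `ℤ³`, and `x` has a positive first coordinate. -/
structure IsPosBasis (x y z : Fin 3 → ℤ) : Prop where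
  pos : 0 < x 0
  span : ∀ u : Fin 3 → ℤ, ∃ a b c : ℤ, u = a • x + b • y + c • z
  area : x 0 * ((starRingEnd ℂ) (proj x y) * proj x z).im = 1

theorem planePart_add (x y : Fin 3 → ℤ) : planePart (x + y) = planePart x + planePart y := by
  apply Complex.ext <;> simp [planePart]

theorem planePart_smul (a : ℤ) (x : Fin 3 → ℤ) : planePart (a • x) = a * planePart x := by
  apply Complex.ext <;> simp [planePart]

theorem proj_add (x y z : Fin 3 → ℤ) : proj x (y + z) = proj x y + proj x z := by
  simp [proj, planePart_add]; ring

theorem proj_smul (a : ℤ) (x y : Fin 3 → ℤ) : proj x (a • y) = a * proj x y := by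
  rw [proj, planePart_smul, Pi.smul_apply, smul_eq_mul, Int.cast_mul, proj]; ring

theorem proj_self {x : Fin 3 → ℤ} (hx : 0 < x 0) : proj x x = 0 := by
  have : (x 0 : ℂ) ≠ 0 := by exact_mod_cast hx.ne'
  simp [proj, center, mul_div_cancel₀, this]

theorem center_sub_center {x w : Fin 3 → ℤ} (hx : 0 < x 0) :
    center w - center x = -(proj w x / x 0) := by
  have hx' : (x 0 : ℂ) ≠ 0 := by exact_mod_cast hx.ne'
  rw [proj, sub_div, mul_div_cancel_left₀ _ hx', center, center]
  ring

theorem proj_eq_neg_mul {x w : Fin 3 → ℤ} (hx : 0 < x 0) (hw : 0 < w 0) :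
    proj w x = -(x 0 / w 0 * proj x w) := by
  have hx' : (x 0 : ℂ) ≠ 0 := by exact_mod_cast hx.ne'
  have hw' : (w 0 : ℂ) ≠ 0 := by exact_mod_cast hw.ne'
  simp only [proj, center]
  field_simp
  ring

theorem proj_eq_add_mul {x w : Fin 3 → ℤ} (hx : 0 < x 0) (y : Fin 3 → ℤ) :
    proj w y = proj x y + y 0 / x 0 * proj w x := by
  have hx' : (x 0 : ℂ) ≠ 0 := by exact_mod_cast hx.ne'
  simp only [proj, center]
  field_simp
  ring

/-- One step of the multidimensional continued fraction. -/
theorem IsPosBasis.step {x y z : Fin 3 → ℤ} (h : IsPosBasis x y z) (N M : ℤ)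
    (hw : 0 < (N • x + M • y + z) 0) : IsPosBasis (N • x + M • y + z) x y := by
  set w := N • x + M • y + z with hwdef
  refine ⟨hw, fun u => ?_, ?_⟩
  · obtain ⟨a, b, c, rfl⟩ := h.span u
    refine ⟨c, a - c * N, b - c * M, ?_⟩
    rw [hwdef]
    module
  · have hxw := proj_eq_neg_mul h.pos hw
    have hpw : proj x w = M * proj x y + proj x z := by
      rw [hwdef, proj_add, proj_add, proj_smul, proj_smul, proj_self h.pos]; ring
    have hw' : (w 0 : ℝ) ≠ 0 := by exact_mod_cast hw.ne'
    rw [proj_eq_add_mul h.pos y, ← h.area]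
    -- A real multiple of `proj w x` does not change the area spanned with `proj w x`.
    have e : ((starRingEnd ℂ) (proj w x) * (proj x y + y 0 / x 0 * proj w x)).im
        = ((starRingEnd ℂ) (proj w x) * proj x y).im := by
      have : (y 0 : ℂ) / x 0 = ((y 0 / x 0 : ℝ) : ℂ) := by push_cast; rfl
      rw [this]
      simp
      ring
    have e2 : (x 0 : ℂ) / w 0 = ((x 0 / w 0 : ℝ) : ℂ) := by push_cast; rfl
    rw [e, hxw, hpw, e2]
    simp
    field_simp
    ring

theorem isPosBasis_standard : IsPosBasis ![1, 0, 0] ![0, 1, 0] ![0, 0, 1] := by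
  refine ⟨by simp, fun u => ⟨u 0, u 1, u 2, ?_⟩, ?_⟩
  · ext i; fin_cases i <;> simp
  · simp [proj, center, planePart]

theorem IsPosBasis.proj_ne_zero {x y z : Fin 3 → ℤ} (h : IsPosBasis x y z) : proj x y ≠ 0 := by
  intro h0
  have := h.area
  simp [h0] at this

/-- Scaling the first basis vector to 1 divides the covolume 1/`x 0` by its squared length. So
height 1/lam corresponds to `x 0 * ‖proj x y‖ ^ 2` = lam. -/
theorem IsPosBasis.div_proj_im {x y z : Fin 3 → ℤ} (h : IsPosBasis x y z) :
    (proj x z / proj x y).im = (x 0 * ‖proj x y‖ ^ 2)⁻¹ := by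
  have h1 := h.area
  have hx : (x 0 : ℝ) ≠ 0 := by exact_mod_cast h.pos.ne'
  have h2 : Complex.normSq (proj x y) ≠ 0 := by simpa using h.proj_ne_zero
  rw [Complex.mul_im, Complex.conj_re, Complex.conj_im] at h1
  refine eq_inv_of_mul_eq_one_right ?_
  rw [Complex.sq_norm, Complex.div_im, ← h1]
  field_simp
  ring

theorem intCast_add_mul (b c : ℤ) (s t : ℝ) :
    (b : ℂ) + c * ⟨s, t⟩ = ⟨b + c * s, c * t⟩ := by
  apply Complex.ext <;> simp

/-- The bound on lam means 1/lam² ≥ 3/4, so the squared norm is at least b² + bc + c², a positive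
definite integral form. Only here does the construction need lam ≤ 2/√3. -/
theorem one_le_norm_add_mul {lam : ℝ} (h0 : 0 < lam) (h1 : lam ≤ 2 / Real.sqrt 3) {b c : ℤ}
    (h : b ≠ 0 ∨ c ≠ 0) : 1 ≤ ‖(b : ℂ) + c * ⟨1 / 2, 1 / lam⟩‖ := by
  have h3 : lam ^ 2 ≤ 4 / 3 := by
    refine (pow_le_pow_left₀ h0.le h1 2).trans_eq ?_
    rw [div_pow, Real.sq_sqrt (by norm_num)]; norm_num
  have h4 : 3 / 4 ≤ 1 / lam ^ 2 := by rw [le_div_iff₀ (by positivity)]; linarith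
  rw [← one_le_sq_iff₀ (norm_nonneg _), Complex.sq_norm, intCast_add_mul, Complex.normSq_apply]
  have h5 : (1 : ℝ) ≤ b ^ 2 + b * c + c ^ 2 := by
    have : 0 < b ^ 2 + b * c + c ^ 2 := by
      by_contra! h'
      have h6 : c = 0 := by nlinarith [sq_nonneg (2 * b + c), sq_nonneg c]
      have h7 : b = 0 := by subst h6; nlinarith
      rcases h with h | h <;> contradiction
    exact_mod_cast this
  have h6 : (c : ℝ) ^ 2 * (3 / 4) ≤ c ^ 2 * (1 / lam ^ 2) := by gcongr
  have h7 : (c : ℝ) * (1 / lam) * (c * (1 / lam)) = c ^ 2 * (1 / lam ^ 2) := by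
    field_simp
  dsimp only
  rw [h7]
  nlinarith

/-- The imaginary part alone gives this. It absorbs the error c(ζ′ − ζ) when the lattice has only
approximately the shape ζ. -/
theorem norm_mul_le_norm_add_mul {lam : ℝ} (h0 : 0 < lam) (b c : ℤ) :
    ‖(c : ℂ)‖ ≤ lam * ‖(b : ℂ) + c * ⟨1 / 2, 1 / lam⟩‖ := by
  have h := Complex.abs_im_le_norm ((b : ℂ) + c * ⟨1 / 2, 1 / lam⟩)
  rw [congrArg Complex.im (intCast_add_mul b c _ _), abs_mul,
    abs_of_pos (by positivity : 0 < 1 / lam)] at h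
  rw [Complex.norm_intCast]
  calc |(c : ℝ)| = lam * (|(c : ℝ)| * (1 / lam)) := by field_simp
    _ ≤ _ := by gcongr

/-- The approximations `q · center x` with `q < x 0` are not much better than `‖proj x y‖` if the
lattice that `proj x y, proj x z` span has nearly the shape `1, 1 / 2 + i / lam`. -/
theorem IsPosBasis.le_norm_mul_center_sub {lam : ℝ} (h0 : 0 < lam) (h1 : lam ≤ 2 / Real.sqrt 3)
    {x y z : Fin 3 → ℤ} (h : IsPosBasis x y z) {q : ℕ} (hq : 1 ≤ q) (hqx : (q : ℤ) < x 0)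
    (m n : ℤ) :
    ‖proj x y‖ * (1 - lam * ‖proj x z / proj x y - ⟨1 / 2, 1 / lam⟩‖) ≤
      ‖(q : ℂ) * center x - ⟨m, n⟩‖ := by
  set ζ : ℂ := ⟨1 / 2, 1 / lam⟩ with hζ
  set ζ' := proj x z / proj x y with hζ'
  obtain ⟨a, b, c, habc⟩ := h.span ![q, m, n]
  -- Otherwise (q, m, n) would be a multiple of x, against 0 < q < `x 0`.
  have hbc : b ≠ 0 ∨ c ≠ 0 := by
    by_contra! h'
    rw [h'.1, h'.2] at habc
    have h2 := congrFun habc 0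
    simp at h2
    rw [h2] at hqx
    have h3 : 0 < a * x 0 := by rw [← h2]; exact_mod_cast hq
    have h4 : 0 < a := pos_of_mul_pos_left h3 h.pos.le
    nlinarith [h.pos]
  have e1 : proj x ![q, m, n] = -((q : ℂ) * center x - ⟨m, n⟩) := by
    simp [proj, planePart]
  have e2 : proj x ![q, m, n] = proj x y * ((b + c * ζ) + c * (ζ' - ζ)) := by
    rw [habc, proj_add, proj_add, proj_smul, proj_smul, proj_smul, proj_self h.pos, hζ']
    have := h.proj_ne_zero
    field_simp
    ring
  rw [← norm_neg ((q : ℂ) * center x - ⟨m, n⟩), ← e1, e2, norm_mul]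
  gcongr
  have h2 := one_le_norm_add_mul h0 h1 hbc
  have h3 := norm_mul_le_norm_add_mul h0 b c
  rw [← hζ] at h2 h3
  have h4 := norm_sub_norm_le ((b : ℂ) + c * ζ) (-(c * (ζ' - ζ)))
  rw [norm_neg, sub_neg_eq_add, norm_mul] at h4
  by_cases h5 : lam * ‖ζ' - ζ‖ ≤ 1
  · nlinarith [norm_nonneg (ζ' - ζ)]
  · exact le_trans (by linarith) (norm_nonneg _)

/-! ### The step to a prescribed lattice shape -/

theorem tendsto_div_of_abs_sub_mul_le {u h : ℕ → ℝ} {a : ℝ} (hh : Tendsto h atTop atTop)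
    (hu : ∀ n, |u n - a * h n| ≤ 1 / 2) : Tendsto (fun n => u n / h n) atTop (𝓝 a) := by
  rw [tendsto_iff_dist_tendsto_zero]
  have h1 : Tendsto (fun n => 1 / 2 / h n) atTop (𝓝 0) := hh.const_div_atTop _
  refine squeeze_zero' (.of_forall fun n => dist_nonneg) ?_ h1
  filter_upwards [hh.eventually_gt_atTop 0] with n hn
  rw [Real.dist_eq, show u n / h n - a = (u n - a * h n) / h n by field_simp, abs_div,
    abs_of_pos hn]
  gcongr
  exact hu n

/-- From bases whose first projection is very short, a single step leads to bases for which the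
projected lattice has asymptotically the shape `1, 1 / 2 + i / lam`. -/
theorem exists_hexagonal_step {lam : ℝ} (h0 : 0 < lam) {X Y Z : ℕ → Fin 3 → ℤ}
    (hS : ∀ᶠ n in atTop, IsPosBasis (X n) (Y n) (Z n))
    (hκ : Tendsto (fun n => (Y n 0 / X n 0 : ℝ)) atTop (𝓝 0))
    (hh : Tendsto (fun n => (X n 0 * ‖proj (X n) (Y n)‖ ^ 2)⁻¹) atTop atTop) :
    ∃ W : ℕ → Fin 3 → ℤ, (∀ᶠ n in atTop, IsPosBasis (W n) (X n) (Y n)) ∧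
      Tendsto (fun n => (W n 0 / X n 0 : ℝ)) atTop atTop ∧
      Tendsto (fun n => W n 0 * ‖proj (W n) (X n)‖ ^ 2) atTop (𝓝 lam) ∧
      (∃ C, Tendsto (fun n => ‖proj (W n) (X n)‖ / ‖proj (X n) (Y n)‖) atTop (𝓝 C)) ∧
      Tendsto (fun n => proj (W n) (Y n) / proj (W n) (X n)) atTop (𝓝 ⟨1 / 2, 1 / lam⟩) := by
  set f : ℕ → ℂ := fun n => proj (X n) (Y n) with hf
  set g : ℕ → ℂ := fun n => proj (X n) (Z n) with hg
  set h : ℕ → ℝ := fun n => (X n 0 * ‖f n‖ ^ 2)⁻¹ with hhdef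
  set c : ℕ → ℝ := fun n => (g n / f n).re with hc
  set κ : ℕ → ℝ := fun n => (Y n 0 / X n 0 : ℝ) with hκdef
  set κ' : ℕ → ℝ := fun n => (Z n 0 / X n 0 : ℝ) with hκ'def
  -- For W = N X + M Y + Z one finds proj W X = −σf and proj W Y / proj W X = κ − 1/σ, where σ = (A
  -- + i)/B. Solving −1/σ = 1/2 + i/lam gives A = −lam/2 and B = lam/4 + 1/lam. M and N are the
  -- nearest integers for these targets; the rounding errors vanish after division by h → ∞.
  set b : ℝ := lam / 4 + 1 / lam with hb
  have hb0 : 0 < b := by positivity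
  have hblam : b * lam = lam ^ 2 / 4 + 1 := by rw [hb]; field_simp
  set M : ℕ → ℤ := fun n => round (-(lam / 2) * h n - c n) with hM
  set N : ℕ → ℤ := fun n => round (b * h n - M n * κ n - κ' n) with hN
  set A : ℕ → ℝ := fun n => (M n + c n) / h n with hA
  set B : ℕ → ℝ := fun n => (N n + M n * κ n + κ' n) / h n with hB
  have hAlim : Tendsto A atTop (𝓝 (-(lam / 2))) := by
    refine tendsto_div_of_abs_sub_mul_le hh fun n => ?_
    rw [abs_sub_comm]
    refine le_of_eq_of_le (congrArg _ ?_) (abs_sub_round (-(lam / 2) * h n - c n))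
    rw [hM]; ring
  have hBlim : Tendsto B atTop (𝓝 b) := by
    refine tendsto_div_of_abs_sub_mul_le hh fun n => ?_
    rw [abs_sub_comm]
    refine le_of_eq_of_le (congrArg _ ?_) (abs_sub_round (b * h n - M n * κ n - κ' n))
    rw [hN]; ring
  set σ : ℕ → ℂ := fun n => (A n + Complex.I) / B n with hσ
  set σ' : ℂ := ((-(lam / 2) : ℝ) + Complex.I) / b with hσ'
  have hbC : (b : ℂ) ≠ 0 := by exact_mod_cast hb0.ne'
  have hσlim : Tendsto σ atTop (𝓝 σ') := by
    refine Tendsto.div ?_ ?_ hbC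
    · exact ((Complex.continuous_ofReal.tendsto _).comp hAlim).add_const _
    · exact (Complex.continuous_ofReal.tendsto _).comp hBlim
  have hσ'0 : σ' ≠ 0 := by
    refine div_ne_zero (fun h' => ?_) hbC
    have := congrArg Complex.im h'
    simp at this
  have hσ'n : b * ‖σ'‖ ^ 2 = lam := by
    rw [hσ', Complex.sq_norm, map_div₀, Complex.normSq_ofReal, Complex.normSq_apply]
    simp
    field_simp
    linarith
  have hσ'inv : -σ'⁻¹ = ⟨1 / 2, 1 / lam⟩ := by
    rw [neg_eq_iff_eq_neg]
    refine inv_eq_of_mul_eq_one_right ?_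
    rw [hσ', div_mul_eq_mul_div, div_eq_one_iff_eq hbC]
    apply Complex.ext
    · simp [hb]; field_simp; ring
    · simp; field_simp; ring
  set W : ℕ → Fin 3 → ℤ := fun n => N n • X n + M n • Y n + Z n with hW
  have hev : ∀ᶠ n in atTop, IsPosBasis (X n) (Y n) (Z n) ∧ 0 < h n ∧ 0 < B n :=
    hS.and ((hh.eventually_gt_atTop 0).and (hBlim.eventually_const_lt hb0))
  have hW0 : ∀ᶠ n in atTop, (W n 0 / X n 0 : ℝ) = B n * h n := by
    filter_upwards [hev] with n ⟨h1, h2, h3⟩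
    have hX : (X n 0 : ℝ) ≠ 0 := by exact_mod_cast h1.pos.ne'
    simp only [hB, hW, hκdef, hκ'def, Pi.add_apply, Pi.smul_apply, smul_eq_mul]
    push_cast
    field_simp
  have hWS : ∀ᶠ n in atTop, IsPosBasis (W n) (X n) (Y n) := by
    filter_upwards [hev, hW0] with n ⟨h1, h2, h3⟩ h4
    refine h1.step _ _ ?_
    have hX : (0 : ℝ) < X n 0 := by exact_mod_cast h1.pos
    have : (0 : ℝ) < W n 0 := by
      rw [div_eq_iff hX.ne'] at h4
      rw [h4]; positivity
    exact_mod_cast this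
  have hw : ∀ᶠ n in atTop, proj (W n) (X n) = -(σ n * f n) := by
    filter_upwards [hev, hW0, hWS] with n ⟨h1, h2, h3⟩ h4 h5
    have hX : (X n 0 : ℂ) ≠ 0 := by exact_mod_cast h1.pos.ne'
    have hW' : (W n 0 : ℂ) ≠ 0 := by exact_mod_cast h5.pos.ne'
    have hf0 : f n ≠ 0 := h1.proj_ne_zero
    have hgf : g n / f n = c n + h n * Complex.I := by
      have h6 : (g n / f n).im = h n := h1.div_proj_im
      rw [← h6]
      exact (Complex.re_add_im _).symm
    have e1 : proj (X n) (W n) = f n * (h n * (A n + Complex.I)) := by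
      simp only [hW]
      rw [proj_add, proj_add, proj_smul, proj_smul, proj_self h1.pos]
      have e2 : (h n : ℂ) * (A n + Complex.I) = M n + g n / f n := by
        have : (h n : ℂ) * A n = M n + c n := by
          rw [← Complex.ofReal_mul, hA, mul_div_cancel₀ _ h2.ne']; push_cast; rfl
        rw [mul_add, this, hgf]; ring
      rw [e2, mul_add, mul_div_cancel₀ _ hf0]
      simp only [hf, hg]
      ring
    have e3 : (W n 0 / X n 0 : ℂ) = B n * h n := by exact_mod_cast congrArg (fun t : ℝ => (t : ℂ)) h4
    have hBC : (B n : ℂ) ≠ 0 := by exact_mod_cast h3.ne'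
    have hhC : (h n : ℂ) ≠ 0 := by exact_mod_cast h2.ne'
    rw [proj_eq_neg_mul h1.pos h5.pos, e1, ← inv_div, e3, hσ]
    field_simp
  refine ⟨W, hWS, ?_, ?_, ⟨‖σ'‖, ?_⟩, ?_⟩
  · refine (hBlim.pos_mul_atTop hb0 hh).congr' ?_
    filter_upwards [hW0] with n hn using hn.symm
  · rw [← hσ'n]
    refine (hBlim.mul (hσlim.norm.pow 2)).congr' ?_
    filter_upwards [hev, hW0, hw] with n ⟨h1, h2, h3⟩ h4 h5
    have hX : (0 : ℝ) < X n 0 := by exact_mod_cast h1.pos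
    have hf0 : 0 < ‖f n‖ := norm_pos_iff.2 h1.proj_ne_zero
    rw [h5, norm_neg, norm_mul]
    rw [div_eq_iff hX.ne'] at h4
    rw [h4]
    simp only [hhdef]
    field_simp
  · refine hσlim.norm.congr' ?_
    filter_upwards [hev, hw] with n ⟨h1, h2, h3⟩ h5
    have hf0 : 0 < ‖f n‖ := norm_pos_iff.2 h1.proj_ne_zero
    rw [h5, norm_neg, norm_mul, mul_div_cancel_right₀ _ hf0.ne']
  · rw [← hσ'inv]
    have : Tendsto (fun n => (κ n : ℂ) - (σ n)⁻¹) atTop (𝓝 (((0 : ℝ) : ℂ) - σ'⁻¹)) :=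
      ((Complex.continuous_ofReal.tendsto _).comp hκ).sub (hσlim.inv₀ hσ'0)
    rw [Complex.ofReal_zero, zero_sub] at this
    refine this.congr' ?_
    filter_upwards [hev, hw, hσlim.eventually_ne hσ'0] with n ⟨h1, h2, h3⟩ h5 h6
    have hf0 : f n ≠ 0 := h1.proj_ne_zero
    have hX : (X n 0 : ℂ) ≠ 0 := by exact_mod_cast h1.pos.ne'
    rw [proj_eq_add_mul h1.pos, h5]
    change _ = (f n + _) / _
    simp only [hκdef]
    push_cast
    field_simp
    ring

/-! ### Two steps, nested balls and the limit point -/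

/-- Two steps of the continued fraction: after the first one the product `t · ψ²` is small, after
the second one it is nearly `lam`. -/
theorem IsPosBasis.exists_two_steps {lam : ℝ} (h0 : 0 < lam) (h1 : lam ≤ 2 / Real.sqrt 3)
    {x y z : Fin 3 → ℤ} (hS : IsPosBasis x y z) {η : ℝ} (hη : 0 < η) :
    ∃ x₁ x₂ : Fin 3 → ℤ, IsPosBasis x₂ x₁ x ∧ x 0 < x₁ 0 ∧ x₁ 0 < x₂ 0 ∧
      ‖center x₂ - center x‖ < η ∧
      x₁ 0 * (x 0 * ‖center x₂ - center x‖) ^ 2 < η ∧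
      x₂ 0 * (x₁ 0 * ‖center x₂ - center x₁‖) ^ 2 < lam + η ∧
      ∃ r > 0, lam - η < (x₂ 0 - 1) * r ^ 2 ∧
        ∀ q : ℕ, 1 ≤ q → (q : ℤ) < x₂ 0 → ∀ m n : ℤ, r ≤ ‖(q : ℂ) * center x₂ - ⟨m, n⟩‖ := by
  have hx : (0 : ℝ) < x 0 := by exact_mod_cast hS.pos
  have hx1 : (1 : ℝ) ≤ x 0 := by exact_mod_cast hS.pos
  -- With the first step n x + z, the error of x is inversely proportional to the new denominator,
  -- so denominator times squared error tends to 0, as the hexagonal step requires.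
  set X : ℕ → Fin 3 → ℤ := fun n => (n : ℤ) • x + (0 : ℤ) • y + z with hX
  have hX0 : ∀ n, (X n 0 : ℝ) = n * x 0 + z 0 := fun n => by simp [hX]
  have hXlim : Tendsto (fun n => (X n 0 : ℝ)) atTop atTop := by
    simp_rw [hX0]
    exact tendsto_atTop_add_const_right _ _
      (tendsto_natCast_atTop_atTop.atTop_mul_const hx)
  have hXpos : ∀ᶠ n in atTop, 0 < X n 0 := by
    filter_upwards [hXlim.eventually_gt_atTop 0] with n hn
    exact_mod_cast hn
  have hXS : ∀ᶠ n in atTop, IsPosBasis (X n) x y := by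
    filter_upwards [hXpos] with n hn using hS.step _ _ hn
  have hκ : Tendsto (fun n => (x 0 / X n 0 : ℝ)) atTop (𝓝 0) := hXlim.const_div_atTop _
  have hg0 : 0 < ‖proj x z‖ := by
    rw [norm_pos_iff]
    intro h
    have := hS.area
    simp [h] at this
  have hf : ∀ᶠ n in atTop, ‖proj (X n) x‖ = x 0 / X n 0 * ‖proj x z‖ := by
    filter_upwards [hXpos] with n hn
    have e : proj x (X n) = proj x z := by
      simp only [hX]
      rw [proj_add, proj_add, proj_smul, proj_smul, proj_self hS.pos]
      simp
    have hn' : (0 : ℝ) < X n 0 := by exact_mod_cast hn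
    rw [proj_eq_neg_mul hS.pos hn, e, norm_neg, norm_mul, norm_div, Complex.norm_intCast,
      Complex.norm_intCast, abs_of_pos hx, abs_of_pos hn']
  have hflim : Tendsto (fun n => ‖proj (X n) x‖) atTop (𝓝 0) := by
    have := hκ.mul_const ‖proj x z‖
    rw [zero_mul] at this
    exact this.congr' (hf.mono fun n hn => hn.symm)
  have hh : Tendsto (fun n => (X n 0 * ‖proj (X n) x‖ ^ 2)⁻¹) atTop atTop := by
    have h2 : 0 < (x 0 ^ 2 * ‖proj x z‖ ^ 2)⁻¹ := by positivity
    refine (hXlim.atTop_mul_const h2).congr' ?_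
    filter_upwards [hf, hXpos] with n hn hn'
    have hn' : (0 : ℝ) < X n 0 := by exact_mod_cast hn'
    rw [hn]
    field_simp
  obtain ⟨W, hWS, hWX, hWlam, ⟨C, hC⟩, hζ⟩ := exists_hexagonal_step h0 hXS hκ hh
  set ρ : ℕ → ℝ := fun n => ‖proj (W n) (X n)‖ / ‖proj (X n) x‖ with hρ
  have hWlim : Tendsto (fun n => (W n 0 : ℝ)) atTop atTop := by
    refine (hWX.atTop_mul_atTop₀ hXlim).congr' ?_
    filter_upwards [hXpos] with n hn
    have hn' : (0 : ℝ) < X n 0 := by exact_mod_cast hn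
    rw [div_mul_cancel₀ _ hn'.ne']
  have hκρ : Tendsto (fun n => 1 + (x 0 / X n 0 : ℝ) * ρ n) atTop (𝓝 1) := by
    have := (hκ.mul hC).const_add 1
    rwa [zero_mul, add_zero] at this
  -- Triangle inequality through `center (X n)`; since ρ converges, the second leg is negligible.
  have hdist : ∀ᶠ n in atTop, x 0 * ‖center (W n) - center x‖ ≤
      ‖proj (X n) x‖ * (1 + (x 0 / X n 0 : ℝ) * ρ n) := by
    filter_upwards [hXS, hWS] with n hn hn'
    have hf0 : 0 < ‖proj (X n) x‖ := norm_pos_iff.2 hn.proj_ne_zero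
    have hXn : (0 : ℝ) < X n 0 := by exact_mod_cast hn.pos
    have e : center (W n) - center x = -(proj (X n) x / x 0) + -(proj (W n) (X n) / X n 0) := by
      rw [← center_sub_center hS.pos, ← center_sub_center hn.pos]; ring
    have e2 : ‖center (W n) - center x‖ ≤
        ‖proj (X n) x‖ / x 0 + ‖proj (W n) (X n)‖ / X n 0 := by
      rw [e]
      refine (norm_add_le _ _).trans_eq ?_
      rw [norm_neg, norm_neg, norm_div, norm_div, Complex.norm_intCast, Complex.norm_intCast,
        abs_of_pos hx, abs_of_pos hXn]
    calc _ ≤ x 0 * (‖proj (X n) x‖ / x 0 + ‖proj (W n) (X n)‖ / X n 0) := by gcongr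
      _ = _ := by simp only [hρ]; field_simp
  have c1 : ∀ᶠ n in atTop, ‖center (W n) - center x‖ < η := by
    have := hflim.mul hκρ
    rw [zero_mul] at this
    filter_upwards [hdist, this.eventually_lt_const hη] with n h2 h3
    refine lt_of_le_of_lt ?_ (h2.trans_lt h3)
    exact le_mul_of_one_le_left (norm_nonneg _) hx1
  have c2 : ∀ᶠ n in atTop, X n 0 * (x 0 * ‖center (W n) - center x‖) ^ 2 < η := by
    have := (tendsto_inv_atTop_zero.comp hh).mul (hκρ.pow 2)
    rw [zero_mul] at this
    filter_upwards [hdist, hXpos, this.eventually_lt_const hη] with n h2 hn h3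
    have hn' : (0 : ℝ) < X n 0 := by exact_mod_cast hn
    refine lt_of_le_of_lt ?_ h3
    simp only [Function.comp_apply, inv_inv]
    rw [mul_assoc, ← mul_pow]
    gcongr
  have c3 : ∀ᶠ n in atTop, W n 0 * (X n 0 * ‖center (W n) - center (X n)‖) ^ 2 < lam + η := by
    filter_upwards [hXpos, hWlam.eventually_lt_const (by linarith : lam < lam + η)] with n hn h2
    have hn' : (0 : ℝ) < X n 0 := by exact_mod_cast hn
    rw [center_sub_center hn, norm_neg, norm_div, Complex.norm_intCast, abs_of_pos hn',
      mul_div_cancel₀ _ hn'.ne']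
    exact h2
  set e : ℕ → ℝ := fun n =>
    1 - lam * ‖proj (W n) x / proj (W n) (X n) - ⟨1 / 2, 1 / lam⟩‖ with he
  have helim : Tendsto e atTop (𝓝 1) := by
    have := ((tendsto_iff_norm_sub_tendsto_zero.1 hζ).const_mul lam).const_sub 1
    rwa [mul_zero, sub_zero] at this
  have c4 : ∀ᶠ n in atTop, lam - η < (W n 0 - 1) * (‖proj (W n) (X n)‖ * e n) ^ 2 := by
    have h2 : Tendsto (fun n => 1 - (1 : ℝ) / W n 0) atTop (𝓝 1) := by
      have := (hWlim.const_div_atTop 1).const_sub 1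
      rwa [sub_zero] at this
    have := (hWlam.mul h2).mul (helim.pow 2)
    rw [one_pow, mul_one, mul_one] at this
    filter_upwards [hWS, this.eventually_const_lt (by linarith : lam - η < lam)] with n hn h3
    have hn' : (0 : ℝ) < W n 0 := by exact_mod_cast hn.pos
    refine h3.trans_eq ?_
    field_simp
  obtain ⟨n, a1, a2, a3, a4, a5, a6, a7, a8, a9⟩ := (c1.and (c2.and (c3.and (c4.and
    ((helim.eventually_const_lt zero_lt_one).and (hWS.and (hXS.and
      ((hXlim.eventually_gt_atTop (x 0 : ℝ)).and (hWX.eventually_gt_atTop 1))))))))).exists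
  have hXn : (0 : ℝ) < X n 0 := by exact_mod_cast a7.pos
  refine ⟨X n, W n, a6, by exact_mod_cast a8, ?_, a1, a2, a3, ‖proj (W n) (X n)‖ * e n,
    mul_pos (norm_pos_iff.2 a6.proj_ne_zero) a5, a4, fun q hq hqW m k =>
    a6.le_norm_mul_center_sub h0 h1 hq hqW m k⟩
  rw [lt_div_iff₀ hXn, one_mul] at a9
  exact_mod_cast a9

theorem psi_le_mul_norm_sub_center (v : EuclideanSpace ℝ (Fin 2)) {x : Fin 3 → ℤ} (hx : 0 < x 0)
    {t : ℝ} (ht : x 0 ≤ t) : psi v t ≤ x 0 * ‖toComplex v - center x‖ := by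
  obtain ⟨q, hq⟩ := Int.eq_ofNat_of_zero_le hx.le
  have hq' : (x 0 : ℝ) = q := by rw [hq]; simp
  have hq1 : 1 ≤ q := by omega
  have hqC : (q : ℂ) ≠ 0 := by exact_mod_cast (by omega : q ≠ 0)
  refine (psi_le v hq1 (hq' ▸ ht) (x 1) (x 2)).trans_eq ?_
  have e : (q : ℂ) * toComplex v - ⟨x 1, x 2⟩ = q * (toComplex v - center x) := by
    rw [center, hq, mul_sub]
    push_cast
    rw [mul_div_cancel₀ _ hqC]
    rfl
  rw [e, norm_mul, hq', Complex.norm_natCast]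

/-- Two steps of the continued fraction control `t · ψ(t)²` on a whole neighbourhood. -/
theorem IsPosBasis.exists_closedBall_subset {lam : ℝ} (h0 : 0 < lam) (h1 : lam ≤ 2 / Real.sqrt 3)
    {x y z : Fin 3 → ℤ} (hS : IsPosBasis x y z) {δ η : ℝ} (hδ : 0 < δ) (hη : 0 < η) :
    ∃ x₁ x₂ : Fin 3 → ℤ, IsPosBasis x₂ x₁ x ∧ x 0 < x₂ 0 ∧ ∃ δ' > 0,
      Metric.closedBall (center x₂) δ' ⊆ Metric.closedBall (center x) δ ∧
      ∀ v, toComplex v ∈ Metric.closedBall (center x₂) δ' →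
        (∀ t : ℝ, x 0 ≤ t → t < x₂ 0 → t * psi v t ^ 2 ≤ lam + η) ∧
        ∃ t : ℝ, x 0 ≤ t ∧ lam - η ≤ t * psi v t ^ 2 := by
  obtain ⟨x₁, x₂, hS', hx1, hx2, hd, b1, b2, r, hr, hr1, hr2⟩ :=
    hS.exists_two_steps h0 h1 (lt_min hδ hη)
  have hx : (0 : ℝ) < x 0 := by exact_mod_cast hS.pos
  have hx1' : (x 0 : ℝ) < x₁ 0 := by exact_mod_cast hx1
  have hx2' : (x₁ 0 : ℝ) < x₂ 0 := by exact_mod_cast hx2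
  -- The strict inequalities survive when v moves by a small s away from `center x₂`.
  have hlim : ∀ {F : ℝ → ℝ} {a b : ℝ}, Continuous F → F 0 = a → a < b →
      ∀ᶠ s in 𝓝[>] (0 : ℝ), F s < b := by
    intro F a b hF h h'
    exact (hF.continuousAt.tendsto.mono_left nhdsWithin_le_nhds).eventually_lt_const (by rwa [h])
  have d1 := hlim (F := fun s => ‖center x₂ - center x‖ + s) (by fun_prop) (add_zero _) hd
  have d2 := hlim (F := fun s => x₁ 0 * (x 0 * (‖center x₂ - center x‖ + s)) ^ 2) (by fun_prop)
    (by simp) b1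
  have d3 := hlim (F := fun s => x₂ 0 * (x₁ 0 * (‖center x₂ - center x₁‖ + s)) ^ 2)
    (by fun_prop) (by simp) b2
  have d4 := hlim (F := fun s => -((x₂ 0 - 1) * (r - x₂ 0 * s) ^ 2)) (by fun_prop)
    (by simp) (neg_lt_neg hr1)
  have d5 := hlim (F := fun s => x₂ 0 * s) (by fun_prop) (by simp) hr
  obtain ⟨s, e1, e2, e3, e4, e5, hs⟩ := (d1.and (d2.and (d3.and (d4.and (d5.and
    (eventually_mem_nhdsWithin)))))).exists
  have hs : 0 < s := hs
  refine ⟨x₁, x₂, hS', hx1.trans hx2, s, hs, ?_, fun v hv => ⟨fun t ht1 ht2 => ?_, ?_⟩⟩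
  · refine Metric.closedBall_subset_closedBall' ?_
    rw [dist_eq_norm]
    linarith [min_le_left δ η]
  · rw [Metric.mem_closedBall, dist_eq_norm] at hv
    have htri : ∀ w : ℂ, ‖toComplex v - w‖ ≤ ‖center x₂ - w‖ + s := fun w => by
      have := norm_add_le (toComplex v - center x₂) (center x₂ - w)
      rw [sub_add_sub_cancel] at this
      linarith
    have ht0 : 0 < t := hx.trans_le ht1
    have hη' := min_le_right δ η
    have key : ∀ u : Fin 3 → ℤ, ∀ T : ℝ, 0 < u 0 → (u 0 : ℝ) ≤ t → t ≤ T → t * psi v t ^ 2 ≤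
        T * (u 0 * (‖center x₂ - center u‖ + s)) ^ 2 := by
      intro u T hu hut htT
      have hu' : (0 : ℝ) < u 0 := by exact_mod_cast hu
      have h1 : psi v t ≤ u 0 * (‖center x₂ - center u‖ + s) :=
        (psi_le_mul_norm_sub_center v hu hut).trans (by gcongr; exact htri _)
      have h2 := psi_nonneg v t
      have h3 : 0 ≤ T := ht0.le.trans htT
      gcongr
    -- The denominator `x 0` serves up to `x₁ 0`, and `x₁ 0` serves from there to `x₂ 0`.
    rcases lt_or_ge t (x₁ 0) with h | h
    · have := key x (x₁ 0) hS.pos ht1 h.le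
      linarith
    · have := key x₁ (x₂ 0) (hS.pos.trans hx1) h ht2.le
      linarith
  · have ht1 : (x 0 : ℝ) ≤ x₂ 0 - 1 := by
      have : x 0 ≤ x₂ 0 - 1 := by omega
      exact_mod_cast this
    have hx' : (1 : ℝ) ≤ x 0 := by exact_mod_cast hS.pos
    -- The denominator `x₂ 0` itself approximates v too well and must stay excluded.
    refine ⟨x₂ 0 - 1, ht1, ?_⟩
    obtain ⟨q, hq, hqt, m, n, hψ⟩ := exists_psi_eq v (t := x₂ 0 - 1) (by linarith)
    have hq2 : (q : ℝ) < x₂ 0 := by linarith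
    have h2 := hr2 q hq (by exact_mod_cast hq2) m n
    rw [Metric.mem_closedBall, dist_eq_norm] at hv
    have h3 : r - x₂ 0 * s ≤ psi v (x₂ 0 - 1) := by
      rw [hψ]
      have h4 := norm_sub_le ((q : ℂ) * toComplex v - ⟨m, n⟩) (q * (toComplex v - center x₂))
      rw [norm_mul, Complex.norm_natCast] at h4
      have h5 : (q : ℂ) * toComplex v - ⟨m, n⟩ - q * (toComplex v - center x₂)
        = q * center x₂ - ⟨m, n⟩ := by ring
      rw [h5] at h4
      have h6 : (q : ℝ) * ‖toComplex v - center x₂‖ ≤ x₂ 0 * s := by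
        have : (0 : ℝ) ≤ x₂ 0 := by linarith
        gcongr
      linarith
    have h7 : (x₂ 0 - 1 : ℝ) * (r - x₂ 0 * s) ^ 2 ≤ (x₂ 0 - 1) * psi v (x₂ 0 - 1) ^ 2 := by
      have : 0 ≤ r - x₂ 0 * s := by linarith
      have : (0 : ℝ) ≤ x₂ 0 - 1 := by linarith
      gcongr
    linarith [min_le_right δ η]

theorem mem_dirichletSpectrum₂ {lam : ℝ} (h0 : 0 < lam) (h1 : lam ≤ 2 / Real.sqrt 3) :
    lam ∈ dirichletSpectrum₂ := by
  let St := {p : (Fin 3 → ℤ) × ℝ // (∃ y z, IsPosBasis p.1 y z) ∧ 0 < p.2}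
  have hnext : ∀ (k : ℕ) (p : St), ∃ p' : St, p.1.1 0 < p'.1.1 0 ∧
      Metric.closedBall (center p'.1.1) p'.1.2 ⊆ Metric.closedBall (center p.1.1) p.1.2 ∧
      ∀ v, toComplex v ∈ Metric.closedBall (center p'.1.1) p'.1.2 →
        (∀ t : ℝ, p.1.1 0 ≤ t → t < p'.1.1 0 → t * psi v t ^ 2 ≤ lam + 1 / ((k : ℝ) + 1)) ∧
        ∃ t : ℝ, p.1.1 0 ≤ t ∧ lam - 1 / ((k : ℝ) + 1) ≤ t * psi v t ^ 2 := by
    rintro k ⟨⟨x, δ⟩, ⟨y, z, hS⟩, hδ⟩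
    obtain ⟨x₁, x₂, hS', hx, δ', hδ', h⟩ :=
      hS.exists_closedBall_subset h0 h1 hδ (Nat.one_div_pos_of_nat (n := k))
    exact ⟨⟨(x₂, δ'), ⟨x₁, x, hS'⟩, hδ'⟩, hx, h⟩
  choose next hn1 hn2 hn3 using hnext
  let s : ℕ → St := fun k =>
    Nat.rec ⟨(![1, 0, 0], 1), ⟨_, _, isPosBasis_standard⟩, one_pos⟩ next k
  have hs : ∀ k, s (k + 1) = next k (s k) := fun k => rfl
  set a : ℕ → ℤ := fun k => (s k).1.1 0 with ha
  have hamono : StrictMono a := strictMono_nat_of_lt_succ fun k => by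
    simp only [ha, hs]; exact hn1 _ _
  have hak : ∀ k : ℕ, (k : ℤ) ≤ a k := by
    intro k
    induction k with
    | zero => exact (s 0).2.1.choose_spec.choose_spec.pos.le
    | succ k ih => have := hamono (Nat.lt_add_one k); push_cast; omega
  obtain ⟨V, hV⟩ : (⋂ k, Metric.closedBall (center (s k).1.1) (s k).1.2).Nonempty := by
    refine IsCompact.nonempty_iInter_of_sequence_nonempty_isCompact_isClosed _
      (fun k => ?_) (fun k => ?_) (isCompact_closedBall _ _) fun k => Metric.isClosed_closedBall
    · rw [hs]; exact hn2 _ _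
    · exact ⟨_, Metric.mem_closedBall_self (s k).2.2.le⟩
  have hV' : toComplex !₂[V.re, V.im] = V := by simp [toComplex]
  rw [Set.mem_iInter, ← hV'] at hV
  have hk := fun k => hn3 k (s k) _ (by rw [← hs]; exact hV (k + 1))
  have hsmall : ∀ η > 0, ∃ K : ℕ, ∀ k ≥ K, 1 / ((k : ℝ) + 1) ≤ η := by
    intro η hη
    obtain ⟨K, hK⟩ := exists_nat_one_div_lt hη
    exact ⟨K, fun k hk => (Nat.one_div_le_one_div hk).trans hK.le⟩
  refine mem_dirichletSpectrum₂_of_forall_eventually !₂[V.re, V.im] (fun η hη => ?_) fun η hη => ?_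
  · obtain ⟨K, hK⟩ := hsmall η hη
    filter_upwards [eventually_ge_atTop (a K : ℝ)] with t ht
    have hex : ∃ j, t < a (K + j) := by
      obtain ⟨j, hj⟩ := exists_nat_gt t
      refine ⟨j, hj.trans_le ?_⟩
      have := (hak j).trans (hamono.monotone (Nat.le_add_left j K))
      exact_mod_cast this
    -- The least such j locates t between consecutive denominators, where the bound of that stage
    -- applies.
    obtain ⟨j, hj, hmin⟩ : ∃ j, t < a (K + j) ∧ ∀ i < j, ¬ t < a (K + i) := by
      classical exact ⟨Nat.find hex, Nat.find_spec hex, fun i hi => Nat.find_min hex hi⟩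
    cases j with
    | zero => exact absurd hj (not_lt.2 ht)
    | succ j =>
      have h2 := (hk (K + j)).1 t (not_lt.1 (hmin j (Nat.lt_succ_self j))) hj
      linarith [hK (K + j) (Nat.le_add_right _ _)]
  · obtain ⟨K, hK⟩ := hsmall η hη
    rw [frequently_atTop]
    intro T
    obtain ⟨j, hj⟩ := exists_nat_gt T
    obtain ⟨t, ht1, ht2⟩ := (hk (K + j)).2
    refine ⟨t, ?_, by linarith [hK (K + j) (Nat.le_add_right _ _)]⟩
    have h2 : (j : ℝ) ≤ a (K + j) := by
      have := (hak j).trans (hamono.monotone (Nat.le_add_left j K))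
      exact_mod_cast this
    exact (hj.le.trans h2).trans ht1

end DirichletSpectrum

theorem mainTheorem1 :
    DirichletSpectrum.dirichletSpectrum₂ = Set.Icc (0 : ℝ) (2 / Real.sqrt 3) := by
  refine Set.Subset.antisymm DirichletSpectrum.dirichletSpectrum₂_subset ?_
  rintro lam ⟨h0, h1⟩
  rcases h0.eq_or_lt with rfl | h0
  · exact DirichletSpectrum.zero_mem_dirichletSpectrum₂
  · exact DirichletSpectrum.mem_dirichletSpectrum₂ h0 h1
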